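/- Let $\sigma:\mathbb R\to\mathbb R$ be an increasing odd homeomorphism, and suppose that there are $a,b>0$ such that $\sigma(x)=ax$ for all $x\in[-b,b]$. Let $E_\sigma:\mathbb R_{\ge 0}^2\to\mathbb R_{\ge 0}^2$ be the generalized Euclidean algorithm, \[ E_\sigma(x,y)=\begin{cases}(x-\sigma^{-1}(y),\,y) & \text{if } y<\sigma(x),\\ (x,\,y-\sigma(x)) & \text{if } y\ge\sigma(x).\end{cases} \] Then $E_\sigma$ is ergodic on $\mathbb R_{\ge 0}^2$ with respect to the Lebesgue measure $\lambda$. That is, $E_\sigma$ is Borel measurable and nonsingular ($\lambda(N)=0$ implies $\lambda(E_\sigma^{-1}(N))=0$ for Borel $N$), and every Borel set $A\subset\mathbb R_{\ge 0}^2$ with $E_\sigma^{-1}(A)=A$ satisfies $\lambda(A)=0$ or $\lambda(\mathbb R_{\ge 0}^2\setminus A)=0$. -/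

import Mathlib

open MeasureTheory

/-- The closed positive quadrant `ℝ²_{≥ 0}` of the plane, as a subtype of `ℝ × ℝ`. -/
abbrev PosQuadrant : Type := {p : ℝ × ℝ // 0 ≤ p.1 ∧ 0 ≤ p.2}

/-- The Lebesgue measure of the plane, restricted to the closed positive quadrant. -/
noncomputable def lebesgueQuadrant : Measure PosQuadrant :=
  Measure.comap Subtype.val (volume : Measure (ℝ × ℝ))

/-- The generalized Euclidean algorithm `E_σ` of an increasing homeomorphism `σ` of the line:
`(x, y) ↦ (x - σ⁻¹ y, y)` if `y < σ x`, and `(x, y) ↦ (x, y - σ x)` if `y ≥ σ x`. -/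
noncomputable def generalizedEuclid (σ : ℝ ≃ₜ ℝ) (hσ : StrictMono σ) (p : PosQuadrant) :
    PosQuadrant :=
  if h : p.1.2 < σ p.1.1 then
    ⟨(p.1.1 - σ.symm p.1.2, p.1.2),
      sub_nonneg.2 (hσ.le_iff_le.1 ((σ.apply_symm_apply p.1.2).trans_le h.le)), p.2.2⟩
  else
    ⟨(p.1.1, p.1.2 - σ p.1.1), p.2.1, sub_nonneg.2 (not_lt.1 h)⟩

/-!
Write `E` for the generalized Euclidean algorithm. On each of its two branches `E` is a shear, so it
is nonsingular. Off the null set of points that reach a coordinate axis, the coordinates of an orbit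
decrease to `0` (`exists_iterate_generalizedEuclid_le`), so almost every orbit enters the box
`[0, b] × [0, a b]`. There `σ` is linear, and after the scaling `(x, y) ↦ (a x, y)` the map `E` is
the classical subtractive Euclidean algorithm `euclidStep`. Hence an `E`-invariant set is determined
up to a null set by a set `A` in the plane that is invariant under `(x + y, y) ↔ (x, y)` and
`(x, x + y) ↔ (x, y)` for positive `x, y` (`EuclidInvariant`), and it remains to show that such an
`A` is null or conull in the open quadrant (`EuclidInvariant.null_or_conull`).

Let `F` be the indicator function of `A`. The row `F (·, t)` is periodic of period `t` on the
half-line; let `c t` be its mean. By induction on `p + q`, for coprime `p > 0` and `q` some element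
of the monoid generated by the two elementary shears maps `(1, 0)` to `(p, q)`, and invariance under
it makes the line `Y = (q X + t) / p` a rescaled copy of the row at height `t`: its restriction of
`F` is periodic of period `t p`, with the same mean. So on the strip
`q X / p < Y < (q X + s) / p`, when `s p` is small, the mean of `F` over a range of `X` is close to
`C s`, the mean of `c` over `(0, s)` (`EuclidInvariant.abs_strip_mean_sub_le`). This value does not
depend on `(p, q)`.

Take `s = θ / N` and all coprime `(p, q)` with `p ≤ N`. By Dirichlet's theorem each slope `σ` is
within `1 / (p N)` of one of the fractions `q / p`, which yields weights, subordinate to these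
intervals, that sum to `1` in `σ`. Replacing each line by an average over the strips near it
changes the integral of a continuous function by an arbitrarily small amount as `N → ∞`. For fixed
`X ≥ θ` the strips are disjoint, and the weighted average over the strips is bounded by `2 / θ`
times Lebesgue measure uniformly in `N` (`sum_fareyWeight_strip_le`), so `F` may be replaced by a
continuous function that is close to it in `L¹`. It follows that the mean of `(X, σ) ↦ F (X, σ X)`
over a box is as close as desired to `C (θ / N)`, for `θ` small and `N` large
(`EuclidInvariant.abs_box_integral_sub_le`). All boxes therefore have the same mean, and by
Lebesgue's density theorem `F` is almost everywhere constant.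
-/

/-! ### Sets invariant under the elementary shears -/

/-- Invariance of a planar set, at points with positive coordinates, under the two inverse branches
`(x, y) ↦ (x + y, y)` and `(x, y) ↦ (x, x + y)` of the subtractive Euclidean algorithm. -/
structure EuclidInvariant (A : Set (ℝ × ℝ)) : Prop where
  add_left : ∀ x y : ℝ, 0 < x → 0 < y → ((x + y, y) ∈ A ↔ (x, y) ∈ A)
  add_right : ∀ x y : ℝ, 0 < x → 0 < y → ((x, x + y) ∈ A ↔ (x, y) ∈ A)

/-- Every primitive vector `(p, q)` is the first column of a product of elementary shears; the set
is invariant under this product. The bound `p' < p` on the second column keeps track of where on the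
line in direction `(p, q)` the invariance is available. -/
theorem EuclidInvariant.exists_basis {A : Set (ℝ × ℝ)} (hA : EuclidInvariant A) (p q : ℕ)
    (hp : 0 < p) (hpq : p.Coprime q) :
    ∃ p' q' : ℕ, p' < p ∧ p * q' = q * p' + 1 ∧ ∀ x y : ℝ, 0 < x → 0 < y →
      ((x * p + y * p', x * q + y * q') ∈ A ↔ (x, y) ∈ A) := by
  induction hn : p + q using Nat.strong_induction_on generalizing p q with
  | _ n ih =>
  rcases le_or_gt p q with h | h
  · obtain ⟨r, rfl⟩ := Nat.exists_eq_add_of_le h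
    have hc : p.Coprime r := by simpa using hpq
    obtain ⟨p', q', h1, h2, h3⟩ := ih (p + r) (by omega) p r hp hc rfl
    refine ⟨p', p' + q', h1, by rw [mul_add, h2]; ring, fun x y hx hy => ?_⟩
    rw [← h3 x y hx hy, ← hA.add_right (x * p + y * p') (x * r + y * q')]
    · push_cast
      have : x * ((p : ℝ) + r) + y * (p' + q') = x * p + y * p' + (x * r + y * q') := by ring
      rw [this]
    · positivity
    · -- the determinant is `1`, so the second row of the matrix is not zero
      have : 0 < q' := by
        rcases Nat.eq_zero_or_pos q' with h0 | h0
        · subst h0; omega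
        · exact h0
      positivity
  · rcases Nat.eq_zero_or_pos q with h0 | h0
    · subst h0
      have : p = 1 := by simpa using hpq
      subst this
      exact ⟨0, 1, by norm_num, by norm_num, fun x y _ _ => by simp⟩
    · obtain ⟨r, rfl⟩ := Nat.exists_eq_add_of_le h.le
      have hr : 0 < r := by omega
      have hc : r.Coprime q := by simpa [Nat.coprime_comm] using hpq
      obtain ⟨p', q', h1, h2, h3⟩ := ih (r + q) (by omega) r q hr hc rfl
      have hq : q' ≤ q := by
        by_contra hcon
        have h4 : r * (q + 1) ≤ r * q' := Nat.mul_le_mul_left _ (by omega)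
        have h5 : q * (p' + 1) ≤ q * r := Nat.mul_le_mul_left _ (by omega)
        nlinarith
      refine ⟨p' + q', q', by omega, by rw [add_mul, h2]; ring, fun x y hx hy => ?_⟩
      rw [← h3 x y hx hy, ← hA.add_left (x * r + y * p') (x * q + y * q')]
      · push_cast
        have : x * ((q : ℝ) + r) + y * (p' + q') = x * r + y * p' + (x * q + y * q') := by ring
        rw [this]
      · positivity
      · positivity

/-- The line `Y = (q X + t) / p` is an affine copy of the horizontal line at height `t`. -/
theorem EuclidInvariant.mem_line_iff {A : Set (ℝ × ℝ)} (hA : EuclidInvariant A) {p q : ℕ}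
    (hp : 0 < p) (hpq : p.Coprime q) :
    ∃ p' : ℕ, p' < p ∧ ∀ t X : ℝ, 0 < t → t * p' < X →
      ((X, (q * X + t) / p) ∈ A ↔ ((X - t * p') / p, t) ∈ A) := by
  obtain ⟨p', q', h1, h2, h3⟩ := hA.exists_basis p q hp hpq
  have hp0 : (0 : ℝ) < p := by exact_mod_cast hp
  have h2' : (p : ℝ) * q' = q * p' + 1 := by exact_mod_cast h2
  refine ⟨p', h1, fun t X ht hX => ?_⟩
  rw [← h3 ((X - t * p') / p) t (div_pos (by linarith) hp0) ht]
  have e1 : (X - t * p') / p * p + t * p' = X := by field_simp; ring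
  have e2 : (X - t * p') / p * q + t * q' = (q * X + t) / p := by
    field_simp
    linear_combination t * h2'
  rw [e1, e2]

/-! ### Means along rows and along rational lines -/

/-- Over any interval of the half-line, the integral of a periodic function differs from what its
mean predicts by at most a period. -/
theorem abs_integral_sub_mean_le {g : ℝ → ℝ} (hg : Measurable g) (h0 : ∀ x, 0 ≤ g x)
    (h1 : ∀ x, g x ≤ 1) {T : ℝ} (hT : 0 < T) (hper : ∀ x, 0 < x → g (x + T) = g x)
    {c : ℝ} (hc : ∫ x in 0..T, g x = T * c) {u w : ℝ} (hu : 0 ≤ u) (hw : 0 ≤ w) :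
    |(∫ x in u..w, g x) - (w - u) * c| ≤ T := by
  have hint : ∀ a b : ℝ, IntervalIntegrable g volume a b := fun a b =>
    (intervalIntegrable_const (c := (1 : ℝ))).mono_fun' hg.aestronglyMeasurable
      (Filter.Eventually.of_forall fun x =>
        (abs_of_nonneg (h0 x)).trans_le (h1 x))
  have hc0 : 0 ≤ c := by
    have : 0 ≤ ∫ x in 0..T, g x := intervalIntegral.integral_nonneg hT.le fun x _ => h0 x
    rw [hc] at this
    exact nonneg_of_mul_nonneg_right this hT
  have hc1 : c ≤ 1 := by
    have : ∫ x in 0..T, g x ≤ ∫ x in 0..T, (1 : ℝ) :=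
      intervalIntegral.integral_mono_on hT.le (hint _ _) (by simp) fun x _ => h1 x
    rw [hc] at this
    simp at this
    nlinarith
  -- the primitive of `g - c` is again periodic, so both endpoints may be moved into `[0, T]`
  set G : ℝ → ℝ := fun z => (∫ x in 0..z, g x) - z * c with hG
  have hGper : ∀ z, 0 ≤ z → G (z + T) = G z := by
    intro z hz
    have e1 : ∫ x in 0..z, g (x + T) = ∫ x in 0..z, g x := by
      refine intervalIntegral.integral_congr_ae (Filter.Eventually.of_forall fun x hx => ?_)
      rw [Set.uIoc_of_le hz] at hx
      exact hper x hx.1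
    have e2 : ∫ x in 0..z, g (x + T) = ∫ x in T..(z + T), g x := by simp
    have e3 := intervalIntegral.integral_add_adjacent_intervals (hint 0 T) (hint T (z + T))
    simp only [hG]
    rw [← e3, ← e2, e1, hc]
    ring
  have hGn : ∀ (n : ℕ) z, 0 ≤ z → G (z + n * T) = G z := by
    intro n
    induction n with
    | zero => intro z _; simp
    | succ n ih =>
      intro z hz
      rw [← ih z hz, ← hGper (z + n * T) (by positivity)]
      push_cast
      ring_nf
  have hred : ∀ z, 0 ≤ z → ∃ z', 0 ≤ z' ∧ z' ≤ T ∧ G z = G z' := by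
    intro z hz
    have hf1 : (⌊z / T⌋₊ : ℝ) * T ≤ z := (le_div_iff₀ hT).1 (Nat.floor_le (by positivity))
    have hf2 : z < ((⌊z / T⌋₊ : ℝ) + 1) * T := (div_lt_iff₀ hT).1 (Nat.lt_floor_add_one _)
    refine ⟨z - ⌊z / T⌋₊ * T, by linarith, by linarith, ?_⟩
    rw [← hGn ⌊z / T⌋₊ (z - ⌊z / T⌋₊ * T) (by linarith)]
    ring_nf
  have hdiff : ∀ a b, G b - G a = (∫ x in a..b, g x) - (b - a) * c := by
    intro a b
    have e3 := intervalIntegral.integral_add_adjacent_intervals (hint 0 a) (hint a b)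
    simp only [hG]
    rw [← e3]; ring
  rw [← hdiff u w]
  obtain ⟨u', hu0, hu1, hu2⟩ := hred u hu
  obtain ⟨w', hw0, hw1, hw2⟩ := hred w hw
  rw [hu2, hw2, hdiff]
  have e5 : (∫ x in u'..w', g x) - (w' - u') * c = ∫ x in u'..w', (g x - c) := by
    rw [intervalIntegral.integral_sub (hint _ _) (by simp)]; simp
  rw [e5]
  calc |∫ x in u'..w', (g x - c)| ≤ 1 * |w' - u'| := by
        rw [← Real.norm_eq_abs (∫ x in u'..w', (g x - c))]
        refine intervalIntegral.norm_integral_le_of_norm_le_const fun x _ => ?_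
        rw [Real.norm_eq_abs, abs_le]
        constructor <;> linarith [h0 x, h1 x]
    _ ≤ T := by rw [one_mul, abs_le]; constructor <;> linarith

/-- The mean of the indicator function of `A` over the segment `(0, t) × {t}`, written over a fixed
interval of integration so that it is visibly measurable in `t`. -/
noncomputable def rowMean (A : Set (ℝ × ℝ)) (t : ℝ) : ℝ :=
  ∫ x in (0 : ℝ)..1, A.indicator (fun _ => (1 : ℝ)) (t * x, t)

theorem indicator_one_nonneg (A : Set (ℝ × ℝ)) (w : ℝ × ℝ) :
    0 ≤ A.indicator (fun _ => (1 : ℝ)) w := Set.indicator_nonneg (fun _ _ => zero_le_one) w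

theorem indicator_one_congr {A : Set (ℝ × ℝ)} {w z : ℝ × ℝ} (h : w ∈ A ↔ z ∈ A) :
    A.indicator (fun _ => (1 : ℝ)) w = A.indicator (fun _ => (1 : ℝ)) z := by
  by_cases hw : w ∈ A
  · rw [Set.indicator_of_mem hw, Set.indicator_of_mem (h.1 hw)]
  · rw [Set.indicator_of_notMem hw, Set.indicator_of_notMem (mt h.2 hw)]

theorem indicator_one_le (A : Set (ℝ × ℝ)) (w : ℝ × ℝ) :
    A.indicator (fun _ => (1 : ℝ)) w ≤ 1 :=
  Set.indicator_le_self' (fun _ _ => zero_le_one) w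

theorem norm_indicator_one_le (A : Set (ℝ × ℝ)) (w : ℝ × ℝ) :
    ‖A.indicator (fun _ => (1 : ℝ)) w‖ ≤ 1 := by
  rw [Real.norm_eq_abs, abs_of_nonneg (indicator_one_nonneg A w)]
  exact indicator_one_le A w

theorem measurable_indicator_one {A : Set (ℝ × ℝ)} (hm : MeasurableSet A) :
    Measurable (A.indicator (fun _ => (1 : ℝ))) := measurable_const.indicator hm

/-- Along the line `Y = (q X + t) / p` the indicator function of `A` has period `t p` and the same
mean as along the row at height `t`. -/
theorem EuclidInvariant.abs_line_integral_sub_le {A : Set (ℝ × ℝ)} (hA : EuclidInvariant A)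
    (hm : MeasurableSet A) {p q : ℕ} (hp : 0 < p) (hpq : p.Coprime q) {t j₀ j₁ : ℝ} (ht : 0 < t)
    (hj : t * p ≤ j₀) (hjj : j₀ ≤ j₁) :
    |(∫ X in j₀..j₁, A.indicator (fun _ => (1 : ℝ)) (X, (q * X + t) / p))
      - (j₁ - j₀) * rowMean A t| ≤ t * p := by
  obtain ⟨p', h1, h2⟩ := hA.mem_line_iff hp hpq
  have hp0 : (0 : ℝ) < p := by exact_mod_cast hp
  have h1' : (p' : ℝ) < p := by exact_mod_cast h1
  have hlt : t * p' < j₀ := lt_of_lt_of_le (mul_lt_mul_of_pos_left h1' ht) hj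
  set g : ℝ → ℝ := fun x => A.indicator (fun _ => (1 : ℝ)) (x, t) with hg
  have hgm : Measurable g := (measurable_indicator_one hm).comp (by fun_prop)
  have e1 : ∫ X in j₀..j₁, A.indicator (fun _ => (1 : ℝ)) (X, (q * X + t) / p)
      = ∫ X in j₀..j₁, g (X / p - t * p' / p) := by
    refine intervalIntegral.integral_congr fun X hX => ?_
    rw [Set.uIcc_of_le hjj] at hX
    have := h2 t X ht (by linarith [hX.1])
    rw [sub_div] at this
    exact indicator_one_congr this
  have e2 : ∫ x in (0 : ℝ)..t, g x = t * rowMean A t := by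
    have := intervalIntegral.mul_integral_comp_mul_left (f := g) (a := 0) (b := 1) t
    simp only [mul_zero, mul_one] at this
    rw [← this]; rfl
  have e3 := abs_integral_sub_mean_le hgm (fun x => indicator_one_nonneg A _)
    (fun x => indicator_one_le A _) ht (fun x hx =>
      indicator_one_congr (hA.add_left x t hx ht)) e2
    (u := j₀ / p - t * p' / p) (w := j₁ / p - t * p' / p)
    (by rw [← sub_div]; exact div_nonneg (by linarith) hp0.le)
    (by rw [← sub_div]; exact div_nonneg (by linarith) hp0.le)
  rw [e1, intervalIntegral.integral_comp_div_sub _ hp0.ne', smul_eq_mul]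
  have e4 : (p : ℝ) * (∫ x in (j₀ / p - t * p' / p)..(j₁ / p - t * p' / p), g x)
      - (j₁ - j₀) * rowMean A t = p * ((∫ x in (j₀ / p - t * p' / p)..(j₁ / p - t * p' / p), g x)
      - (j₁ / p - t * p' / p - (j₀ / p - t * p' / p)) * rowMean A t) := by
    field_simp
    ring
  rw [e4, abs_mul, abs_of_pos hp0, mul_comm t (p : ℝ)]
  exact mul_le_mul_of_nonneg_left e3 hp0.le

/-! ### Weights subordinate to Farey fractions -/

/-- The coprime pairs `(p, q)` with `0 < p ≤ N` and `q / p ≤ K + 1`, standing for the fractions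
`q / p`. The margin in the last bound leaves room for fractions slightly above `K`. -/
def fareyPairs (K N : ℕ) : Finset (ℕ × ℕ) :=
  (Finset.Icc 1 N ×ˢ Finset.range ((K + 1) * N + 1)).filter
    fun v => v.1.Coprime v.2 ∧ v.2 ≤ (K + 1) * v.1

theorem mem_fareyPairs {K N : ℕ} {v : ℕ × ℕ} :
    v ∈ fareyPairs K N ↔ (0 < v.1 ∧ v.1 ≤ N) ∧ v.1.Coprime v.2 ∧ v.2 ≤ (K + 1) * v.1 := by
  simp only [fareyPairs, Finset.mem_filter, Finset.mem_product, Finset.mem_Icc, Finset.mem_range]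
  constructor
  · rintro ⟨⟨h1, _⟩, h2⟩; exact ⟨h1, h2⟩
  · rintro ⟨h1, h2⟩
    refine ⟨⟨h1, ?_⟩, h2⟩
    have := Nat.mul_le_mul_left (K + 1) h1.2
    omega

/-- Dirichlet's approximation theorem on `[0, K]`. -/
theorem exists_fareyPair_near {K N : ℕ} (hN : 0 < N) {σ : ℝ} (h0 : 0 ≤ σ) (hK : σ ≤ K) :
    ∃ v ∈ fareyPairs K N, |σ - v.2 / v.1| ≤ 1 / (v.1 * N) := by
  obtain ⟨r, hr, hrN⟩ := Real.exists_rat_abs_sub_le_and_den_le σ hN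
  have hd : (0 : ℝ) < r.den := by exact_mod_cast r.den_pos
  have hN' : (0 : ℝ) < N := by exact_mod_cast hN
  have hcast : (r : ℝ) = r.num / r.den := by exact_mod_cast (Rat.num_div_den r).symm
  have hlt : 1 / (((N : ℝ) + 1) * r.den) < 1 / r.den := by
    apply one_div_lt_one_div_of_lt hd; nlinarith
  have hnum : 0 ≤ r.num := by
    by_contra hcon
    have h1 : r.num ≤ -1 := by omega
    have h2 : (r.num : ℝ) ≤ -1 := by exact_mod_cast h1
    have h3 : (r : ℝ) ≤ -1 / r.den := by rw [hcast]; gcongr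
    have h4 := (abs_le.1 hr).2
    have h5 : (-1 : ℝ) / r.den = - (1 / r.den) := by ring
    linarith
  have hcast2 : (r : ℝ) = (r.num.natAbs : ℝ) / r.den := by
    rw [hcast, ← Int.cast_natCast (R := ℝ) r.num.natAbs, Int.natAbs_of_nonneg hnum]
  refine ⟨(r.den, r.num.natAbs), mem_fareyPairs.2 ⟨⟨r.den_pos, hrN⟩, ?_, ?_⟩, ?_⟩
  · exact r.reduced.symm
  · have h1 := (abs_le.1 hr).1
    have h2 : (1 : ℝ) / r.den ≤ 1 := by
      rw [div_le_one hd]; exact_mod_cast r.den_pos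
    have h3 : (r : ℝ) ≤ K + 1 := by linarith
    rw [hcast2, div_le_iff₀ hd] at h3
    exact_mod_cast h3
  · simp only
    rw [← hcast2]
    refine hr.trans (one_div_le_one_div_of_le (by positivity) ?_)
    nlinarith

/-- The partition of unity on `[0, K]` in which every fraction `q / p` within `1 / (p N)` of `σ` has
the same weight at `σ`. Where no fraction is that close, the quotient is `0 / 0 = 0`. -/
noncomputable def fareyWeight (K N : ℕ) (v : ℕ × ℕ) (σ : ℝ) : ℝ :=
  (Metric.closedBall ((v.2 : ℝ) / v.1) (1 / (v.1 * N))).indicator (fun _ => (1 : ℝ)) σ /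
    ∑ w ∈ fareyPairs K N,
      (Metric.closedBall ((w.2 : ℝ) / w.1) (1 / (w.1 * N))).indicator (fun _ => (1 : ℝ)) σ

section
variable {K N : ℕ}

theorem fareyWeight_nonneg (v : ℕ × ℕ) (σ : ℝ) : 0 ≤ fareyWeight K N v σ :=
  div_nonneg (Set.indicator_nonneg (fun _ _ => zero_le_one) _)
    (Finset.sum_nonneg fun _ _ => Set.indicator_nonneg (fun _ _ => zero_le_one) _)

theorem measurable_fareyWeight (v : ℕ × ℕ) : Measurable (fareyWeight K N v) :=
  (measurable_const.indicator measurableSet_closedBall).div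
    (Finset.measurable_sum _ fun _ _ => measurable_const.indicator measurableSet_closedBall)

theorem fareyWeight_le_indicator {v : ℕ × ℕ} (hv : v ∈ fareyPairs K N) (σ : ℝ) :
    fareyWeight K N v σ ≤
      (Metric.closedBall ((v.2 : ℝ) / v.1) (1 / (v.1 * N))).indicator (fun _ => (1 : ℝ)) σ := by
  by_cases h : σ ∈ Metric.closedBall ((v.2 : ℝ) / v.1) (1 / (v.1 * N))
  · unfold fareyWeight
    apply div_le_self (Set.indicator_nonneg (fun _ _ => zero_le_one) _)
    refine le_trans ?_ (Finset.single_le_sum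
      (fun w _ => Set.indicator_nonneg (fun _ _ => zero_le_one) _) hv)
    rw [Set.indicator_of_mem h]
  · rw [fareyWeight, Set.indicator_of_notMem h, zero_div]

theorem fareyWeight_le_one {v : ℕ × ℕ} (hv : v ∈ fareyPairs K N) (σ : ℝ) :
    fareyWeight K N v σ ≤ 1 :=
  (fareyWeight_le_indicator hv σ).trans (Set.indicator_le_self' (fun _ _ => zero_le_one) _)

theorem abs_sub_le_of_fareyWeight_ne_zero {v : ℕ × ℕ} {σ : ℝ} (h : fareyWeight K N v σ ≠ 0) :
    |σ - v.2 / v.1| ≤ 1 / (v.1 * N) := by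
  by_contra hcon
  apply h
  have : σ ∉ Metric.closedBall ((v.2 : ℝ) / v.1) (1 / (v.1 * N)) := by
    rwa [Metric.mem_closedBall, Real.dist_eq]
  rw [fareyWeight, Set.indicator_of_notMem this, zero_div]

theorem sum_fareyWeight (hN : 0 < N) {σ : ℝ} (h0 : 0 ≤ σ) (hK : σ ≤ K) :
    ∑ v ∈ fareyPairs K N, fareyWeight K N v σ = 1 := by
  obtain ⟨v, hv, hvσ⟩ := exists_fareyPair_near hN h0 hK
  unfold fareyWeight
  rw [← Finset.sum_div]
  refine div_self (ne_of_gt (Finset.sum_pos' (fun w _ =>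
    Set.indicator_nonneg (fun _ _ => zero_le_one) _) ⟨v, hv, ?_⟩))
  have : σ ∈ Metric.closedBall ((v.2 : ℝ) / v.1) (1 / (v.1 * N)) := by
    rwa [Metric.mem_closedBall, Real.dist_eq]
  rw [Set.indicator_of_mem this]; exact one_pos

theorem intervalIntegrable_fareyWeight {v : ℕ × ℕ} (hv : v ∈ fareyPairs K N) (α β : ℝ) :
    IntervalIntegrable (fareyWeight K N v) volume α β :=
  (intervalIntegrable_const (c := (1 : ℝ))).mono_fun'
    (measurable_fareyWeight v).aestronglyMeasurable
    (Filter.Eventually.of_forall fun x =>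
      (abs_of_nonneg (fareyWeight_nonneg v x)).trans_le (fareyWeight_le_one hv x))

theorem integral_fareyWeight_le {v : ℕ × ℕ} (hv : v ∈ fareyPairs K N) {α β : ℝ} (h : α ≤ β) :
    ∫ σ in α..β, fareyWeight K N v σ ≤ 2 / (v.1 * N) := by
  rw [intervalIntegral.integral_of_le h]
  set B := Metric.closedBall ((v.2 : ℝ) / v.1) (1 / (v.1 * N)) with hB
  have hBi : Integrable (B.indicator (fun _ => (1 : ℝ))) volume :=
    (integrable_indicator_iff measurableSet_closedBall).2
      (integrableOn_const (hs := measure_closedBall_lt_top.ne))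
  have hi := intervalIntegrable_fareyWeight hv α β
  rw [intervalIntegrable_iff_integrableOn_Ioc_of_le h] at hi
  calc ∫ σ in Set.Ioc α β, fareyWeight K N v σ
      ≤ ∫ σ in Set.Ioc α β, B.indicator (fun _ => (1 : ℝ)) σ :=
        integral_mono hi hBi.integrableOn fun σ => fareyWeight_le_indicator hv σ
    _ ≤ ∫ σ, B.indicator (fun _ => (1 : ℝ)) σ :=
        setIntegral_le_integral hBi (Filter.Eventually.of_forall fun σ =>
          Set.indicator_nonneg (fun _ _ => zero_le_one) _)
    _ = 2 / (v.1 * N) := by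
        rw [integral_indicator measurableSet_closedBall]
        simp only [integral_const, smul_eq_mul, mul_one, measureReal_restrict_apply_univ]
        rw [Measure.real, Real.volume_closedBall, ENNReal.toReal_ofReal (by positivity)]
        ring

theorem sum_integral_fareyWeight (hN : 0 < N) {α β : ℝ} (h0 : 0 ≤ α) (h : α ≤ β) (hK : β ≤ K) :
    ∑ v ∈ fareyPairs K N, ∫ σ in α..β, fareyWeight K N v σ = β - α := by
  rw [← intervalIntegral.integral_finsetSum fun v hv => intervalIntegrable_fareyWeight hv α β]
  have : ∫ σ in α..β, ∑ v ∈ fareyPairs K N, fareyWeight K N v σ = ∫ σ in α..β, (1 : ℝ) := by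
    refine intervalIntegral.integral_congr fun σ hσ => ?_
    rw [Set.uIcc_of_le h] at hσ
    exact sum_fareyWeight hN (h0.trans hσ.1) (hσ.2.trans hK)
  rw [this]; simp

end

section
variable {K N : ℕ}

/-! ### Averaging over strips -/

/-- For `X ≥ θ` the strips `q X / p < Y ≤ (q X + θ / N) / p` over the Farey pairs are disjoint,
since distinct fractions differ by at least the inverse of the product of their denominators. The
weight of a strip is at most `2 / (p N)` and its width is `θ / (p N)`, so the density of the
weighted average with respect to Lebesgue measure is at most `2 / θ`, uniformly in `N`. -/
theorem sum_fareyWeight_strip_le {g : ℝ → ℝ} (hg : Integrable g) (h0 : ∀ y, 0 ≤ g y) (hN : 0 < N)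
    {θ X α β : ℝ} (hθ : 0 < θ) (hθX : θ ≤ X) (hαβ : α ≤ β) :
    ∑ v ∈ fareyPairs K N, (∫ σ in α..β, fareyWeight K N v σ) *
      ((N / θ) * ∫ t in (0 : ℝ)..(θ / N), g ((v.2 * X + t) / v.1)) ≤ 2 / θ * ∫ y, g y := by
  have hN' : (0 : ℝ) < N := by exact_mod_cast hN
  set S : ℕ × ℕ → Set ℝ := fun v => Set.Ioc (v.2 * X / v.1) (v.2 * X / v.1 + θ / N / v.1) with hS
  have hdisj : Set.PairwiseDisjoint (↑(fareyPairs K N)) S := by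
    have key : ∀ v ∈ fareyPairs K N, ∀ w ∈ fareyPairs K N,
        v.2 * w.1 < w.2 * v.1 → Disjoint (S v) (S w) := by
      intro v hv w hw hlt
      rw [mem_fareyPairs] at hv hw
      have hv0 : (0 : ℝ) < v.1 := by exact_mod_cast hv.1.1
      have hw0 : (0 : ℝ) < w.1 := by exact_mod_cast hw.1.1
      have hwN : (w.1 : ℝ) ≤ N := by exact_mod_cast hw.1.2
      have hlt' : (v.2 : ℝ) * w.1 + 1 ≤ w.2 * v.1 := by exact_mod_cast hlt
      refine Set.disjoint_left.2 fun y hy hy' => ?_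
      have h1 : v.2 * X / v.1 + θ / N / v.1 ≤ w.2 * X / w.1 := by
        rw [← add_div, div_le_div_iff₀ hv0 hw0]
        have h2 : θ / N * w.1 ≤ θ := by
          rw [div_mul_eq_mul_div, div_le_iff₀ hN']; nlinarith
        nlinarith
      exact absurd (hy.2.trans h1) (not_le.2 hy'.1)
    intro v hv w hw hvw
    rcases lt_trichotomy (v.2 * w.1) (w.2 * v.1) with h | h | h
    · exact key v hv w hw h
    · exfalso
      have hv' := mem_fareyPairs.1 (Finset.mem_coe.1 hv)
      have hw' := mem_fareyPairs.1 (Finset.mem_coe.1 hw)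
      have d1 : v.1 ∣ w.1 := hv'.2.1.dvd_of_dvd_mul_left (h ▸ Dvd.intro_left _ rfl)
      have d2 : w.1 ∣ v.1 := hw'.2.1.dvd_of_dvd_mul_left (h ▸ Dvd.intro_left _ rfl)
      have e1 : v.1 = w.1 := Nat.dvd_antisymm d1 d2
      rw [e1] at h
      exact hvw (Prod.ext e1 (Nat.eq_of_mul_eq_mul_right hw'.1.1 h))
    · exact (key w hw v hv h).symm
  have hterm : ∀ v ∈ fareyPairs K N, (∫ σ in α..β, fareyWeight K N v σ) *
      ((N / θ) * ∫ t in (0 : ℝ)..(θ / N), g ((v.2 * X + t) / v.1)) ≤ 2 / θ * ∫ y in S v, g y := by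
    intro v hv
    have hv0 : (0 : ℝ) < v.1 := by exact_mod_cast (mem_fareyPairs.1 hv).1.1
    have hs : 0 < θ / N / v.1 := by positivity
    have e : ∫ t in (0 : ℝ)..(θ / N), g ((v.2 * X + t) / v.1) = v.1 * ∫ y in S v, g y := by
      simp_rw [add_div]
      rw [intervalIntegral.integral_comp_add_div _ hv0.ne', zero_div, add_zero,
        intervalIntegral.integral_of_le (by linarith), smul_eq_mul]
    have hnn : 0 ≤ ∫ y in S v, g y := integral_nonneg h0
    rw [e]
    calc _ ≤ 2 / (v.1 * N) * (N / θ * (v.1 * ∫ y in S v, g y)) :=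
          mul_le_mul_of_nonneg_right (integral_fareyWeight_le hv hαβ) (by positivity)
      _ = _ := by field_simp
  calc _ ≤ ∑ v ∈ fareyPairs K N, 2 / θ * ∫ y in S v, g y := Finset.sum_le_sum hterm
    _ = 2 / θ * ∫ y in ⋃ v ∈ fareyPairs K N, S v, g y := by
        rw [← Finset.mul_sum, integral_biUnion_finset _ (fun _ _ => measurableSet_Ioc) hdisj
          fun v _ => hg.integrableOn]
    _ ≤ 2 / θ * ∫ y, g y := by
        refine mul_le_mul_of_nonneg_left ?_ (by positivity)
        exact setIntegral_le_integral hg (Filter.Eventually.of_forall h0)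

theorem intervalIntegrable_of_measurable_bounded {g : ℝ → ℝ} (hg : Measurable g) {C : ℝ}
    (hC : ∀ x, |g x| ≤ C) (a b : ℝ) : IntervalIntegrable g volume a b :=
  (intervalIntegrable_const (c := C)).mono_fun' hg.aestronglyMeasurable
    (Filter.Eventually.of_forall hC)

/-- On a fixed vertical line, the weighted average over the strips is close to the integral over the
slopes. The error for a continuous function `ψ` comes from its modulus of continuity, since each
strip is within `(X + θ) / N` of the points to which it contributes; passing from `h` to `ψ` costs a
multiple of the `L¹` distance that does not depend on `N`. -/
theorem abs_sum_fareyWeight_strip_sub_le {h ψ : ℝ → ℝ} (hh : Measurable h) (hb : ∀ y, |h y| ≤ 1)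
    (hψ : Continuous ψ) (hi : Integrable fun y => h y - ψ y) {d ω : ℝ}
    (hω : ∀ y z, |y - z| ≤ d → |ψ y - ψ z| ≤ ω) (hN : 0 < N) {θ X α β : ℝ} (hθ : 0 < θ)
    (hθX : θ ≤ X) (hd : X + θ ≤ d * N) (hα : 0 ≤ α) (hαβ : α ≤ β) (hβ : β ≤ K) :
    |(∑ v ∈ fareyPairs K N, (∫ σ in α..β, fareyWeight K N v σ) *
        ((N / θ) * ∫ t in (0 : ℝ)..(θ / N), h ((v.2 * X + t) / v.1)))
      - ∫ σ in α..β, h (σ * X)| ≤ ω * (β - α) + (2 / θ + 1 / X) * ∫ y, |h y - ψ y| := by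
  have hN' : (0 : ℝ) < N := by exact_mod_cast hN
  have hX : 0 < X := hθ.trans_le hθX
  have hs : 0 < θ / N := by positivity
  set m : (ℝ → ℝ) → ℕ × ℕ → ℝ := fun f v =>
    (N / θ) * ∫ t in (0 : ℝ)..(θ / N), f ((v.2 * X + t) / v.1) with hm
  set W : ℕ × ℕ → ℝ := fun v => ∫ σ in α..β, fareyWeight K N v σ with hW
  have hW0 : ∀ v, 0 ≤ W v := fun v =>
    intervalIntegral.integral_nonneg hαβ fun σ _ => fareyWeight_nonneg v σ
  have hih : ∀ (v : ℕ × ℕ) a b,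
      IntervalIntegrable (fun t => h ((v.2 * X + t) / v.1)) volume a b := fun v a b =>
    intervalIntegrable_of_measurable_bounded (hh.comp (by fun_prop)) (fun _ => hb _) a b
  have hiψ : ∀ (v : ℕ × ℕ) a b,
      IntervalIntegrable (fun t => ψ ((v.2 * X + t) / v.1)) volume a b := fun v a b =>
    (hψ.comp (by fun_prop : Continuous fun t : ℝ => ((v.2 : ℝ) * X + t) / v.1)).intervalIntegrable
      a b
  have hihX : IntervalIntegrable (fun σ => h (σ * X)) volume α β :=
    intervalIntegrable_of_measurable_bounded (hh.comp (by fun_prop)) (fun _ => hb _) _ _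
  have hiψX : IntervalIntegrable (fun σ => ψ (σ * X)) volume α β :=
    (hψ.comp (by fun_prop : Continuous fun σ : ℝ => σ * X)).intervalIntegrable _ _
  have step1 : |(∑ v ∈ fareyPairs K N, W v * m h v) - ∑ v ∈ fareyPairs K N, W v * m ψ v|
      ≤ 2 / θ * ∫ y, |h y - ψ y| := by
    refine le_trans ?_ (sum_fareyWeight_strip_le (K := K) hi.abs (fun y => abs_nonneg _) hN hθ hθX
      hαβ)
    rw [← Finset.sum_sub_distrib]
    refine (Finset.abs_sum_le_sum_abs _ _).trans (Finset.sum_le_sum fun v _ => ?_)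
    rw [← mul_sub, abs_mul, abs_of_nonneg (hW0 v)]
    refine mul_le_mul_of_nonneg_left ?_ (hW0 v)
    simp only [hm]
    rw [← mul_sub, abs_mul, abs_of_pos (by positivity : (0 : ℝ) < N / θ),
      ← intervalIntegral.integral_sub (hih v _ _) (hiψ v _ _)]
    exact mul_le_mul_of_nonneg_left
      (intervalIntegral.abs_integral_le_integral_abs hs.le) (by positivity)
  have step2 : |(∑ v ∈ fareyPairs K N, W v * m ψ v) - ∫ σ in α..β, ψ (σ * X)| ≤ ω * (β - α) := by
    have hiu : ∀ v ∈ fareyPairs K N,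
        IntervalIntegrable (fun σ => fareyWeight K N v σ * (m ψ v - ψ (σ * X))) volume α β := by
      intro v hv
      refine (intervalIntegrable_fareyWeight hv α β).mul_continuousOn ?_
      exact (continuous_const.sub (hψ.comp (by fun_prop))).continuousOn
    have e : (∑ v ∈ fareyPairs K N, W v * m ψ v) - ∫ σ in α..β, ψ (σ * X)
        = ∫ σ in α..β, ∑ v ∈ fareyPairs K N, fareyWeight K N v σ * (m ψ v - ψ (σ * X)) := by
      have e1 : ∑ v ∈ fareyPairs K N, W v * m ψ v
          = ∫ σ in α..β, ∑ v ∈ fareyPairs K N, fareyWeight K N v σ * m ψ v := by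
        rw [intervalIntegral.integral_finsetSum fun v hv =>
          (intervalIntegrable_fareyWeight hv α β).mul_const _]
        simp only [hW, intervalIntegral.integral_mul_const]
      rw [e1, ← intervalIntegral.integral_sub _ hiψX]
      · refine intervalIntegral.integral_congr fun σ hσ => ?_
        rw [Set.uIcc_of_le hαβ] at hσ
        simp only [mul_sub, Finset.sum_sub_distrib, ← Finset.sum_mul]
        rw [sum_fareyWeight hN (hα.trans hσ.1) (hσ.2.trans hβ), one_mul]
      · have := IntervalIntegrable.sum (fareyPairs K N)
          (f := fun v σ => fareyWeight K N v σ * m ψ v) (μ := volume) (a := α) (b := β)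
          fun v hv => (intervalIntegrable_fareyWeight hv α β).mul_const _
        simpa [Finset.sum_fn] using this
    rw [e]
    have hbd : ∀ σ ∈ Set.uIoc α β,
        ‖∑ v ∈ fareyPairs K N, fareyWeight K N v σ * (m ψ v - ψ (σ * X))‖ ≤ ω := by
      intro σ hσ
      rw [Set.uIoc_of_le hαβ] at hσ
      rw [Real.norm_eq_abs]
      calc _ ≤ ∑ v ∈ fareyPairs K N, fareyWeight K N v σ * ω := by
            refine (Finset.abs_sum_le_sum_abs _ _).trans (Finset.sum_le_sum fun v hv => ?_)
            rw [abs_mul, abs_of_nonneg (fareyWeight_nonneg v σ)]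
            by_cases hz : fareyWeight K N v σ = 0
            · simp [hz]
            refine mul_le_mul_of_nonneg_left ?_ (fareyWeight_nonneg v σ)
            have hclose := abs_sub_le_of_fareyWeight_ne_zero hz
            have hv1 := (mem_fareyPairs.1 hv).1
            have hp1 : (1 : ℝ) ≤ v.1 := by exact_mod_cast hv1.1
            have hp0 : (0 : ℝ) < v.1 := by linarith
            have e2 : m ψ v - ψ (σ * X) = (N / θ) *
                ∫ t in (0 : ℝ)..(θ / N), (ψ ((v.2 * X + t) / v.1) - ψ (σ * X)) := by
              rw [intervalIntegral.integral_sub (hiψ v _ _) (by simp)]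
              simp only [hm, intervalIntegral.integral_const, sub_zero, smul_eq_mul]
              field_simp
            have h3 : ‖∫ t in (0 : ℝ)..(θ / N), (ψ ((v.2 * X + t) / v.1) - ψ (σ * X))‖
                ≤ ω * |θ / N - 0| := by
              refine intervalIntegral.norm_integral_le_of_norm_le_const fun t ht => ?_
              rw [Set.uIoc_of_le hs.le] at ht
              refine hω _ _ ?_
              have e3 : (v.2 * X + t) / v.1 - σ * X = t / v.1 - (σ - v.2 / v.1) * X := by
                field_simp; ring
              rw [e3]
              have h4 : |t / (v.1 : ℝ)| ≤ θ / N := by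
                rw [abs_of_pos (div_pos ht.1 hp0)]
                exact (div_le_self ht.1.le hp1).trans ht.2
              have h5 : |(σ - v.2 / v.1) * X| ≤ 1 / N * X := by
                rw [abs_mul, abs_of_pos hX]
                refine mul_le_mul_of_nonneg_right (hclose.trans ?_) hX.le
                exact one_div_le_one_div_of_le hN' (by nlinarith)
              calc _ ≤ θ / N + 1 / N * X := (abs_sub _ _).trans (add_le_add h4 h5)
                _ = (X + θ) / N := by ring
                _ ≤ d := by rwa [div_le_iff₀ hN']
            rw [e2, abs_mul, abs_of_pos (by positivity : (0 : ℝ) < N / θ)]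
            rw [Real.norm_eq_abs, sub_zero, abs_of_pos hs] at h3
            calc _ ≤ N / θ * (ω * (θ / N)) := mul_le_mul_of_nonneg_left h3 (by positivity)
              _ = ω := by field_simp
        _ = ω := by
            rw [← Finset.sum_mul, sum_fareyWeight hN (hα.trans hσ.1.le) (hσ.2.trans hβ), one_mul]
    have := intervalIntegral.norm_integral_le_of_norm_le_const hbd
    rwa [abs_of_nonneg (by linarith : 0 ≤ β - α), Real.norm_eq_abs] at this
  have step3 : |(∫ σ in α..β, ψ (σ * X)) - ∫ σ in α..β, h (σ * X)|
      ≤ 1 / X * ∫ y, |h y - ψ y| := by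
    rw [← intervalIntegral.integral_sub hiψX hihX]
    refine (intervalIntegral.abs_integral_le_integral_abs hαβ).trans ?_
    have e := intervalIntegral.integral_comp_mul_right (a := α) (b := β)
      (fun y => |ψ y - h y|) hX.ne'
    rw [e, smul_eq_mul, one_div]
    refine mul_le_mul_of_nonneg_left ?_ (by positivity)
    rw [intervalIntegral.integral_of_le (by nlinarith)]
    simp_rw [abs_sub_comm (ψ _)]
    exact setIntegral_le_integral hi.abs (Filter.Eventually.of_forall fun y => abs_nonneg _)
  calc _ ≤ |(∑ v ∈ fareyPairs K N, W v * m h v) - ∑ v ∈ fareyPairs K N, W v * m ψ v|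
        + |(∑ v ∈ fareyPairs K N, W v * m ψ v) - ∫ σ in α..β, ψ (σ * X)|
        + |(∫ σ in α..β, ψ (σ * X)) - ∫ σ in α..β, h (σ * X)| := by
        refine le_trans (le_of_eq ?_) (abs_add_three _ _ _)
        congr 1; ring
    _ ≤ _ := by linarith
end

theorem measurable_intervalIntegral_right {G : ℝ × ℝ → ℝ} (hG : Measurable G) (a b : ℝ) :
    Measurable fun x => ∫ y in a..b, G (x, y) := by
  simp only [intervalIntegral]
  exact (StronglyMeasurable.integral_prod_right' hG.stronglyMeasurable).measurable.sub
    (StronglyMeasurable.integral_prod_right' hG.stronglyMeasurable).measurable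

theorem abs_intervalIntegral_le {g : ℝ → ℝ} (h : ∀ x, |g x| ≤ 1) (a b : ℝ) :
    |∫ x in a..b, g x| ≤ |b - a| := by
  have := intervalIntegral.norm_integral_le_of_norm_le_const (f := g) (a := a) (b := b) (C := 1)
    fun x _ => h x
  rwa [one_mul] at this

theorem intervalIntegral_swap {G : ℝ × ℝ → ℝ} (hG : Measurable G) (hb : ∀ w, |G w| ≤ 1)
    {a b c d : ℝ} (hab : a ≤ b) (hcd : c ≤ d) :
    ∫ x in a..b, ∫ y in c..d, G (x, y) = ∫ y in c..d, ∫ x in a..b, G (x, y) := by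
  simp only [intervalIntegral.integral_of_le hab, intervalIntegral.integral_of_le hcd]
  refine integral_integral_swap ?_
  refine (integrable_const (1 : ℝ)).mono' hG.aestronglyMeasurable
    (Filter.Eventually.of_forall fun w => hb w)

theorem measurable_rowMean {A : Set (ℝ × ℝ)} (hm : MeasurableSet A) : Measurable (rowMean A) :=
  measurable_intervalIntegral_right
    (G := fun w => A.indicator (fun _ => (1 : ℝ)) (w.1 * w.2, w.1))
    ((measurable_indicator_one hm).comp (by fun_prop)) 0 1

/-- The mean over a strip along the line of slope `q / p` does not depend on `(p, q)`, up to an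
error of one period. -/
theorem EuclidInvariant.abs_strip_mean_sub_le {A : Set (ℝ × ℝ)} (hA : EuclidInvariant A)
    (hm : MeasurableSet A) {p q : ℕ} (hp : 0 < p) (hpq : p.Coprime q) {s j₀ j₁ : ℝ} (hs : 0 < s)
    (hj : s * p ≤ j₀) (hjj : j₀ ≤ j₁) :
    |(∫ X in j₀..j₁, s⁻¹ * ∫ t in (0 : ℝ)..s,
        A.indicator (fun _ => (1 : ℝ)) (X, (q * X + t) / p))
      - (j₁ - j₀) * (s⁻¹ * ∫ t in (0 : ℝ)..s, rowMean A t)| ≤ s * p := by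
  have hF := measurable_indicator_one hm
  have hp0 : (0 : ℝ) < p := by exact_mod_cast hp
  rw [intervalIntegral.integral_const_mul, intervalIntegral_swap
    (G := fun w => A.indicator (fun _ => (1 : ℝ)) (w.1, (q * w.1 + w.2) / p))
    (hF.comp (by fun_prop)) (fun _ => norm_indicator_one_le A _) hjj hs.le]
  have e : s⁻¹ * (∫ t in (0 : ℝ)..s, ∫ X in j₀..j₁,
        A.indicator (fun _ => (1 : ℝ)) (X, (q * X + t) / p))
      - (j₁ - j₀) * (s⁻¹ * ∫ t in (0 : ℝ)..s, rowMean A t)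
      = s⁻¹ * ∫ t in (0 : ℝ)..s, ((∫ X in j₀..j₁,
        A.indicator (fun _ => (1 : ℝ)) (X, (q * X + t) / p)) - (j₁ - j₀) * rowMean A t) := by
    rw [intervalIntegral.integral_sub, intervalIntegral.integral_const_mul]
    · ring
    · refine intervalIntegrable_of_measurable_bounded
        (measurable_intervalIntegral_right
          (G := fun w => A.indicator (fun _ => (1 : ℝ)) (w.2, (q * w.2 + w.1) / p))
          (hF.comp (by fun_prop)) _ _) (C := |j₁ - j₀|) (fun t => ?_) _ _
      exact abs_intervalIntegral_le (fun _ => norm_indicator_one_le A _) _ _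
    · refine (intervalIntegrable_of_measurable_bounded (measurable_rowMean hm) (C := |1 - 0|)
        (fun t => ?_) _ _).const_mul _
      exact abs_intervalIntegral_le (fun _ => norm_indicator_one_le A _) _ _
  rw [e, abs_mul, abs_of_pos (inv_pos.2 hs)]
  have h3 := intervalIntegral.norm_integral_le_of_norm_le_const (a := 0) (b := s) (C := s * p)
    (f := fun t => (∫ X in j₀..j₁,
        A.indicator (fun _ => (1 : ℝ)) (X, (q * X + t) / p)) - (j₁ - j₀) * rowMean A t)
    (fun t ht => by
      rw [Set.uIoc_of_le hs.le] at ht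
      have hts : t * p ≤ s * p := mul_le_mul_of_nonneg_right ht.2 hp0.le
      exact (hA.abs_line_integral_sub_le hm hp hpq ht.1 (hts.trans hj) hjj).trans hts)
  rw [sub_zero, abs_of_pos hs, Real.norm_eq_abs] at h3
  calc _ ≤ s⁻¹ * (s * p * s) := mul_le_mul_of_nonneg_left h3 (inv_pos.2 hs).le
    _ = s * p := by field_simp

/-- In the coordinates `(X, σ)` with `σ = Y / X`, the mean of the indicator function of `A` over a
box is approximated by the mean of the row means over `(0, θ / N)`. The approximating value does not
depend on the box. -/
theorem EuclidInvariant.abs_box_integral_sub_le {A : Set (ℝ × ℝ)} (hA : EuclidInvariant A)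
    (hm : MeasurableSet A) {j₀ j₁ α β : ℝ} (hj : 0 < j₀) (hjj : j₀ < j₁) (hα : 0 ≤ α)
    (hαβ : α < β) {η : ℝ} (hη : 0 < η) :
    ∃ θ₀ > 0, ∀ θ : ℝ, 0 < θ → θ ≤ θ₀ → ∃ N₀ : ℕ, ∀ N : ℕ, N₀ ≤ N → 0 < N →
      |(∫ X in j₀..j₁, ∫ σ in α..β, A.indicator (fun _ => (1 : ℝ)) (X, σ * X))
        - (β - α) * (j₁ - j₀) * ((θ / N)⁻¹ * ∫ t in (0 : ℝ)..(θ / N), rowMean A t)| ≤ η := by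
  obtain ⟨K, hK⟩ := exists_nat_ge β
  have hI : 0 < β - α := sub_pos.2 hαβ
  have hJ : 0 < j₁ - j₀ := sub_pos.2 hjj
  refine ⟨min j₀ (η / 3 / (β - α)), lt_min hj (by positivity), fun θ hθ hθ₀ => ?_⟩
  have hθj : θ ≤ j₀ := hθ₀.trans (min_le_left _ _)
  have hθI : (β - α) * θ ≤ η / 3 := by
    have := hθ₀.trans (min_le_right _ _)
    rw [le_div_iff₀ hI] at this
    linarith
  set F : ℝ × ℝ → ℝ := A.indicator (fun _ => (1 : ℝ)) with hF
  have hFm : Measurable F := measurable_indicator_one hm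
  -- only points of `Z` matter below; truncating to `Z` makes the indicator function integrable
  set Z : Set (ℝ × ℝ) := Set.Icc 0 j₁ ×ˢ Set.Icc 0 ((K + 2) * j₁) with hZ
  have hZm : MeasurableSet Z := measurableSet_Icc.prod measurableSet_Icc
  have hZfin : volume Z < ⊤ := (isCompact_Icc.prod isCompact_Icc).measure_lt_top
  set B : Set (ℝ × ℝ) := A ∩ Z with hB
  have hBm : MeasurableSet B := hm.inter hZm
  set H : ℝ × ℝ → ℝ := B.indicator (fun _ => (1 : ℝ)) with hH
  have hHm : Measurable H := measurable_indicator_one hBm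
  have hHF : ∀ w ∈ Z, H w = F w := by
    intro w hw
    by_cases hwA : w ∈ A
    · rw [hH, hF, Set.indicator_of_mem hwA, Set.indicator_of_mem (show w ∈ B from ⟨hwA, hw⟩)]
    · rw [hH, hF, Set.indicator_of_notMem hwA, Set.indicator_of_notMem fun h => hwA h.1]
  have hHi : Integrable H (volume : Measure (ℝ × ℝ)) :=
    (integrable_indicator_iff hBm).2
      (integrableOn_const (hs := ((measure_mono Set.inter_subset_right).trans_lt hZfin).ne))
  have hC : 0 < 2 / θ + 1 / j₀ := by positivity
  obtain ⟨φ, hφc, hφε, hφ, hφi⟩ := hHi.exists_hasCompactSupport_integral_sub_le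
    (ε := η / 3 / (2 / θ + 1 / j₀)) (by positivity)
  have hωpos : 0 < η / 3 / ((β - α) * (j₁ - j₀)) := by positivity
  set ω := η / 3 / ((β - α) * (j₁ - j₀)) with hωdef
  obtain ⟨d', hd', hφd⟩ := Metric.uniformContinuous_iff.1
    (hφc.uniformContinuous_of_continuous hφ) ω hωpos
  have hd : 0 < d' / 2 := by positivity
  obtain ⟨N₀, hN₀⟩ := exists_nat_ge ((j₁ + θ) / (d' / 2))
  refine ⟨N₀, fun N hNN hN => ?_⟩
  have hN' : (0 : ℝ) < N := by exact_mod_cast hN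
  have hs : 0 < θ / N := by positivity
  have hdN : j₁ + θ ≤ d' / 2 * N := by
    rw [div_le_iff₀ hd] at hN₀
    have : (N₀ : ℝ) ≤ N := by exact_mod_cast hNN
    nlinarith
  set W : ℕ × ℕ → ℝ := fun v => ∫ σ in α..β, fareyWeight K N v σ with hW
  have hW0 : ∀ v, 0 ≤ W v := fun v =>
    intervalIntegral.integral_nonneg hαβ.le fun σ _ => fareyWeight_nonneg v σ
  have hWsum : ∑ v ∈ fareyPairs K N, W v = β - α :=
    sum_integral_fareyWeight hN hα hαβ.le hK
  set V : ℝ → ℝ := fun X => ∫ σ in α..β, F (X, σ * X) with hV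
  set M : ℕ × ℕ → ℝ → ℝ := fun v X =>
    (θ / N)⁻¹ * ∫ t in (0 : ℝ)..(θ / N), F (X, (v.2 * X + t) / v.1) with hMdef
  set T : ℝ → ℝ := fun X => ∑ v ∈ fareyPairs K N, W v * M v X with hT
  have hVi : IntervalIntegrable V volume j₀ j₁ :=
    intervalIntegrable_of_measurable_bounded
      (measurable_intervalIntegral_right (G := fun w => F (w.1, w.2 * w.1))
        (hFm.comp (by fun_prop)) _ _) (C := |β - α|)
      (fun X => abs_intervalIntegral_le (fun _ => norm_indicator_one_le A _) _ _) _ _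
  have hMi : ∀ v, IntervalIntegrable (M v) volume j₀ j₁ := fun v =>
    (intervalIntegrable_of_measurable_bounded
      (measurable_intervalIntegral_right (G := fun w => F (w.1, (v.2 * w.1 + w.2) / v.1))
        (hFm.comp (by fun_prop)) _ _) (C := |θ / N - 0|)
      (fun X => abs_intervalIntegral_le (fun _ => norm_indicator_one_le A _) _ _) _ _).const_mul _
  have hTi : IntervalIntegrable T volume j₀ j₁ := by
    have := IntervalIntegrable.sum (fareyPairs K N)
      (f := fun v X => W v * M v X) (μ := volume) (a := j₀) (b := j₁)
      fun v hv => (hMi v).const_mul _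
    simpa [Finset.sum_fn, hT] using this
  set e : ℝ → ℝ := fun X => ∫ y, ‖H (X, y) - φ (X, y)‖ with he
  have hdi : Integrable (fun w => H w - φ w) ((volume : Measure ℝ).prod volume) := by
    rw [← Measure.volume_eq_prod]; exact hHi.sub hφi
  have hei : Integrable e volume := hdi.integral_norm_prod_left
  have hetot : ∫ X, e X ≤ η / 3 / (2 / θ + 1 / j₀) := by
    refine le_trans (le_of_eq ?_) hφε
    rw [Measure.volume_eq_prod]
    exact (integral_prod _ hdi.norm).symm
  have hae : ∀ᵐ X ∂(volume : Measure ℝ), X ∈ Set.Icc j₀ j₁ →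
      |T X - V X| ≤ ω * (β - α) + (2 / θ + 1 / j₀) * e X := by
    filter_upwards [hdi.prod_right_ae] with X hX hXJ
    have hX0 : 0 < X := hj.trans_le hXJ.1
    have hmain := abs_sum_fareyWeight_strip_sub_le (K := K) (h := fun y => H (X, y))
      (ψ := fun y => φ (X, y)) (hHm.comp (by fun_prop)) (fun _ => norm_indicator_one_le B _)
      (hφ.comp (by fun_prop)) hX (d := d' / 2) (ω := ω)
      (fun y z hyz => by
        have : dist (X, y) (X, z) < d' := by
          rw [dist_prod_same_left, Real.dist_eq]; linarith
        exact (hφd this).le)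
      hN hθ (hθj.trans hXJ.1) (by linarith [hXJ.2]) hα hαβ.le hK
    have eV : ∫ σ in α..β, H (X, σ * X) = V X := by
      refine intervalIntegral.integral_congr fun σ hσ => hHF _ ?_
      rw [Set.uIcc_of_le hαβ.le] at hσ
      have h0 : 0 ≤ σ := hα.trans hσ.1
      refine ⟨⟨hX0.le, hXJ.2⟩, mul_nonneg h0 hX0.le, ?_⟩
      refine mul_le_mul ?_ hXJ.2 hX0.le (by positivity)
      linarith [hσ.2]
    have eT : ∑ v ∈ fareyPairs K N, (∫ σ in α..β, fareyWeight K N v σ) *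
        ((N / θ) * ∫ t in (0 : ℝ)..(θ / N), H (X, (v.2 * X + t) / v.1)) = T X := by
      refine Finset.sum_congr rfl fun v hv => ?_
      simp only [hMdef, inv_div]
      congr 2
      refine intervalIntegral.integral_congr fun t ht => hHF _ ?_
      rw [Set.uIcc_of_le hs.le] at ht
      obtain ⟨⟨hv1, hvN⟩, -, hv3⟩ := mem_fareyPairs.1 hv
      have hp1 : (1 : ℝ) ≤ v.1 := by exact_mod_cast hv1
      have hq : (v.2 : ℝ) ≤ (K + 1) * v.1 := by exact_mod_cast hv3
      have hN1 : (1 : ℝ) ≤ N := by exact_mod_cast hN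
      have htj : t ≤ j₁ := ht.2.trans ((div_le_self hθ.le hN1).trans (hθj.trans hjj.le))
      refine ⟨⟨hX0.le, hXJ.2⟩, ?_, ?_⟩
      · have := ht.1
        positivity
      · rw [div_le_iff₀ (by linarith)]
        have h1 : (v.2 : ℝ) * X ≤ (K + 1) * v.1 * j₁ :=
          mul_le_mul hq hXJ.2 hX0.le (by positivity)
        have h2 : t ≤ v.1 * j₁ := htj.trans (le_mul_of_one_le_left (by linarith) hp1)
        nlinarith
    rw [eV, eT] at hmain
    refine hmain.trans (add_le_add le_rfl (mul_le_mul_of_nonneg_right ?_ ?_))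
    · have := one_div_le_one_div_of_le hj hXJ.1
      linarith
    · exact integral_nonneg fun y => abs_nonneg _
  have hdiff : |(∫ X in j₀..j₁, T X) - ∫ X in j₀..j₁, V X| ≤ η / 3 + η / 3 := by
    rw [← intervalIntegral.integral_sub hTi hVi]
    refine (intervalIntegral.abs_integral_le_integral_abs hjj.le).trans ?_
    calc _ ≤ ∫ X in j₀..j₁, (ω * (β - α) + (2 / θ + 1 / j₀) * e X) := by
          refine intervalIntegral.integral_mono_ae_restrict hjj.le (hTi.sub hVi).abs
            (intervalIntegrable_const.add (hei.intervalIntegrable.const_mul _)) ?_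
          rw [Filter.EventuallyLE, ae_restrict_iff' measurableSet_Icc]
          exact hae
      _ = ω * (β - α) * (j₁ - j₀) + (2 / θ + 1 / j₀) * ∫ X in j₀..j₁, e X := by
          rw [intervalIntegral.integral_add intervalIntegrable_const
            (hei.intervalIntegrable.const_mul _),
            intervalIntegral.integral_const_mul (2 / θ + 1 / j₀)]
          simp only [intervalIntegral.integral_const, smul_eq_mul]
          ring
      _ ≤ η / 3 + (2 / θ + 1 / j₀) * (η / 3 / (2 / θ + 1 / j₀)) := by
          refine add_le_add (le_of_eq ?_) (mul_le_mul_of_nonneg_left (le_trans ?_ hetot) hC.le)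
          · rw [hωdef]; field_simp
          · rw [intervalIntegral.integral_of_le hjj.le]
            exact setIntegral_le_integral hei
              (Filter.Eventually.of_forall fun X => integral_nonneg fun y => norm_nonneg _)
      _ = η / 3 + η / 3 := by rw [mul_div_cancel₀ _ hC.ne']
  set Cs := (θ / N)⁻¹ * ∫ t in (0 : ℝ)..(θ / N), rowMean A t with hCs
  have hTC : |(∫ X in j₀..j₁, T X) - (β - α) * (j₁ - j₀) * Cs| ≤ η / 3 := by
    have e1 : (∫ X in j₀..j₁, T X) - (β - α) * (j₁ - j₀) * Cs
        = ∑ v ∈ fareyPairs K N, W v * ((∫ X in j₀..j₁, M v X) - (j₁ - j₀) * Cs) := by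
      simp only [hT]
      rw [intervalIntegral.integral_finsetSum fun v hv => (hMi v).const_mul _]
      simp only [mul_sub, Finset.sum_sub_distrib, intervalIntegral.integral_const_mul,
        ← Finset.sum_mul, hWsum]
      ring
    rw [e1]
    calc _ ≤ ∑ v ∈ fareyPairs K N, W v * θ := by
          refine (Finset.abs_sum_le_sum_abs _ _).trans (Finset.sum_le_sum fun v hv => ?_)
          rw [abs_mul, abs_of_nonneg (hW0 v)]
          refine mul_le_mul_of_nonneg_left ?_ (hW0 v)
          obtain ⟨⟨hv1, hvN⟩, hv2, -⟩ := mem_fareyPairs.1 hv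
          have hsp : θ / N * v.1 ≤ θ := by
            rw [div_mul_eq_mul_div, div_le_iff₀ hN']
            exact mul_le_mul_of_nonneg_left (by exact_mod_cast hvN) hθ.le
          exact (hA.abs_strip_mean_sub_le hm hv1 hv2 hs (hsp.trans hθj) hjj.le).trans hsp
      _ = (β - α) * θ := by rw [← Finset.sum_mul, hWsum]
      _ ≤ η / 3 := hθI
  have := abs_sub_le (∫ X in j₀..j₁, V X) (∫ X in j₀..j₁, T X) ((β - α) * (j₁ - j₀) * Cs)
  rw [abs_sub_comm (∫ X in j₀..j₁, V X) (∫ X in j₀..j₁, T X)] at this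
  linarith

/-! ### Invariant sets are null or conull -/

theorem EuclidInvariant.box_average_eq {A : Set (ℝ × ℝ)} (hA : EuclidInvariant A)
    (hm : MeasurableSet A) {j₀ j₁ α β j₀' j₁' α' β' : ℝ} (hj : 0 < j₀) (hjj : j₀ < j₁)
    (hα : 0 ≤ α) (hαβ : α < β) (hj' : 0 < j₀') (hjj' : j₀' < j₁') (hα' : 0 ≤ α') (hαβ' : α' < β') :
    (∫ X in j₀..j₁, ∫ σ in α..β, A.indicator (fun _ => (1 : ℝ)) (X, σ * X))
        / ((β - α) * (j₁ - j₀))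
      = (∫ X in j₀'..j₁', ∫ σ in α'..β', A.indicator (fun _ => (1 : ℝ)) (X, σ * X))
        / ((β' - α') * (j₁' - j₀')) := by
  have hR : 0 < (β - α) * (j₁ - j₀) := mul_pos (sub_pos.2 hαβ) (sub_pos.2 hjj)
  have hR' : 0 < (β' - α') * (j₁' - j₀') := mul_pos (sub_pos.2 hαβ') (sub_pos.2 hjj')
  refine eq_of_forall_dist_le fun ε hε => ?_
  obtain ⟨θ₁, hθ₁, h₁⟩ := hA.abs_box_integral_sub_le hm hj hjj hα hαβ
    (η := ε / 2 * ((β - α) * (j₁ - j₀))) (by positivity)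
  obtain ⟨θ₂, hθ₂, h₂⟩ := hA.abs_box_integral_sub_le hm hj' hjj' hα' hαβ'
    (η := ε / 2 * ((β' - α') * (j₁' - j₀'))) (by positivity)
  have hθ : 0 < min θ₁ θ₂ := lt_min hθ₁ hθ₂
  obtain ⟨N₁, h₁⟩ := h₁ _ hθ (min_le_left _ _)
  obtain ⟨N₂, h₂⟩ := h₂ _ hθ (min_le_right _ _)
  have h₁ := h₁ (max N₁ N₂ + 1) (by omega) (by omega)
  have h₂ := h₂ (max N₁ N₂ + 1) (by omega) (by omega)
  set C := (min θ₁ θ₂ / ((max N₁ N₂ + 1 : ℕ) : ℝ))⁻¹ *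
    ∫ t in (0 : ℝ)..(min θ₁ θ₂ / ((max N₁ N₂ + 1 : ℕ) : ℝ)), rowMean A t
  have key : ∀ V R : ℝ, 0 < R → |V - R * C| ≤ ε / 2 * R → |V / R - C| ≤ ε / 2 := by
    intro V R hR h
    have : V / R - C = (V - R * C) / R := by field_simp
    rw [this, abs_div, abs_of_pos hR, div_le_iff₀ hR]
    exact h
  have k₁ := key _ _ hR h₁
  have k₂ := key _ _ hR' h₂
  rw [Real.dist_eq]
  rw [abs_le] at *
  constructor <;> linarith

/-- The open positive quadrant. -/
def openQuadrant : Set (ℝ × ℝ) := Set.Ioi 0 ×ˢ Set.Ioi 0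

theorem volume_inter_closedBall_eq {A : Set (ℝ × ℝ)} (hm : MeasurableSet A) (x s : ℝ) {r : ℝ}
    (hr : 0 < r) :
    volume (((fun z : ℝ × ℝ => (z.1, z.2 * z.1)) ⁻¹' A) ∩ Metric.closedBall (x, s) r)
      = ENNReal.ofReal (∫ X in (x - r)..(x + r), ∫ σ in (s - r)..(s + r),
          A.indicator (fun _ => (1 : ℝ)) (X, σ * X)) := by
  set D := (fun z : ℝ × ℝ => (z.1, z.2 * z.1)) ⁻¹' A with hD
  have hDm : MeasurableSet D := hm.preimage (by fun_prop)
  have hfin : volume (Metric.closedBall (x, s) r) ≠ ⊤ := measure_closedBall_lt_top.ne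
  have hint : IntegrableOn (D.indicator fun _ => (1 : ℝ))
      (Set.Icc (x - r) (x + r) ×ˢ Set.Icc (s - r) (s + r)) (volume.prod volume) := by
    refine Measure.integrableOn_of_bounded (M := 1) ?_
      (measurable_indicator_one hDm).aestronglyMeasurable
      (Filter.Eventually.of_forall fun w => norm_indicator_one_le D w)
    rw [← Real.closedBall_eq_Icc, ← Real.closedBall_eq_Icc, closedBall_prod_same,
      ← Measure.volume_eq_prod]
    exact hfin
  have e1 : ∫ X in (x - r)..(x + r), ∫ σ in (s - r)..(s + r),
      A.indicator (fun _ => (1 : ℝ)) (X, σ * X)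
      = ∫ w in Metric.closedBall (x, s) r, D.indicator (fun _ => (1 : ℝ)) w := by
    rw [← closedBall_prod_same, Real.closedBall_eq_Icc, Real.closedBall_eq_Icc,
      Measure.volume_eq_prod, setIntegral_prod _ hint, integral_Icc_eq_integral_Ioc,
      intervalIntegral.integral_of_le (by linarith)]
    refine integral_congr_ae (Filter.Eventually.of_forall fun X => ?_)
    simp only
    rw [integral_Icc_eq_integral_Ioc, intervalIntegral.integral_of_le (by linarith)]
    rfl
  rw [e1, integral_indicator hDm, Measure.restrict_restrict hDm]
  simp only [integral_const, smul_eq_mul, mul_one, measureReal_restrict_apply_univ]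
  rw [Measure.real, ENNReal.ofReal_toReal]
  exact measure_ne_top_of_subset Set.inter_subset_right hfin

/-- The subtractive Euclidean algorithm is ergodic on the open quadrant. -/
theorem EuclidInvariant.null_or_conull {A : Set (ℝ × ℝ)} (hA : EuclidInvariant A)
    (hm : MeasurableSet A) :
    volume (openQuadrant ∩ A) = 0 ∨ volume (openQuadrant \ A) = 0 := by
  set D := (fun z : ℝ × ℝ => (z.1, z.2 * z.1)) ⁻¹' A with hD
  have hDm : MeasurableSet D := hm.preimage (by fun_prop)
  obtain ⟨κ, hκ⟩ : ∃ κ : ℝ, ∀ j₀ j₁ α β : ℝ, 0 < j₀ → j₀ < j₁ → 0 ≤ α → α < β →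
      (∫ X in j₀..j₁, ∫ σ in α..β, A.indicator (fun _ => (1 : ℝ)) (X, σ * X))
        = κ * ((β - α) * (j₁ - j₀)) := by
    refine ⟨_, fun j₀ j₁ α β h1 h2 h3 h4 => (div_eq_iff ?_).1
      (hA.box_average_eq hm h1 h2 h3 h4 one_pos one_lt_two zero_le_one one_lt_two)⟩
    exact (mul_pos (sub_pos.2 h4) (sub_pos.2 h2)).ne'
  -- balls of the sup metric are boxes, so the density of `D` at almost every point is `κ`
  have hae : ∀ᵐ z : ℝ × ℝ, z ∈ openQuadrant →
      D.indicator (1 : ℝ × ℝ → ENNReal) z = ENNReal.ofReal κ := by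
    filter_upwards [Besicovitch.ae_tendsto_measure_inter_div_of_measurableSet volume hDm]
      with z hz hzQ
    obtain ⟨x, s⟩ := z
    refine tendsto_nhds_unique hz (tendsto_const_nhds.congr' ?_)
    have hx : 0 < x := hzQ.1
    have hs : 0 < s := hzQ.2
    filter_upwards [Ioo_mem_nhdsGT (lt_min hx hs)] with r hr
    have hr0 : 0 < r := hr.1
    have hrx : r < x := hr.2.trans_le (min_le_left _ _)
    have hrs : r < s := hr.2.trans_le (min_le_right _ _)
    have hpos : 0 < (s + r - (s - r)) * (x + r - (x - r)) :=
      mul_pos (by linarith) (by linarith)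
    have e2 : volume (Metric.closedBall (x, s) r)
        = ENNReal.ofReal ((s + r - (s - r)) * (x + r - (x - r))) := by
      rw [← closedBall_prod_same, Measure.volume_eq_prod, Measure.prod_prod, Real.volume_closedBall,
        Real.volume_closedBall, ← ENNReal.ofReal_mul (by positivity)]
      congr 1; ring
    rw [volume_inter_closedBall_eq hm x s hr0, hκ _ _ _ _ (by linarith) (by linarith)
      (by linarith) (by linarith), e2, ← ENNReal.ofReal_div_of_pos hpos,
      mul_div_cancel_right₀ _ hpos.ne']
  -- a null set of slope coordinates gives a null set of points
  have himage : ∀ P : Set (ℝ × ℝ), volume (openQuadrant ∩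
      (fun z : ℝ × ℝ => (z.1, z.2 * z.1)) ⁻¹' P) = 0 → volume (openQuadrant ∩ P) = 0 := by
    intro P hP
    refine measure_mono_null ?_ (addHaar_image_eq_zero_of_differentiableOn_of_addHaar_eq_zero
      (f := fun z : ℝ × ℝ => (z.1, z.2 * z.1)) volume (by fun_prop) hP)
    rintro ⟨X, Y⟩ ⟨⟨hX, hY⟩, hP⟩
    have hX : 0 < X := hX
    have hY : 0 < Y := hY
    have e : Y / X * X = Y := div_mul_cancel₀ _ hX.ne'
    exact ⟨(X, Y / X), ⟨⟨hX, div_pos hY hX⟩, by simpa [e] using hP⟩, by simp [e]⟩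
  -- the constant value of the indicator function decides which alternative holds
  by_cases h0 : ENNReal.ofReal κ = 0
  · left
    refine himage A ?_
    rw [measure_eq_zero_iff_ae_notMem]
    filter_upwards [hae] with z hz hzA
    have := hz hzA.1
    rw [h0, Set.indicator_of_mem hzA.2] at this
    exact one_ne_zero this
  · right
    rw [Set.sdiff_eq]
    refine himage Aᶜ ?_
    rw [measure_eq_zero_iff_ae_notMem]
    filter_upwards [hae] with z hz hzA
    have := hz hzA.1
    rw [Set.indicator_of_notMem (show z ∉ D from hzA.2)] at this
    exact h0 this.symm

/-! ### The subtractive Euclidean algorithm -/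

/-- The subtractive Euclidean algorithm, on the whole plane. -/
noncomputable def euclidStep (w : ℝ × ℝ) : ℝ × ℝ :=
  if w.2 < w.1 then (w.1 - w.2, w.2) else (w.1, w.2 - w.1)

theorem measurable_euclidStep : Measurable euclidStep :=
  Measurable.ite (measurableSet_lt measurable_snd measurable_fst) (by fun_prop) (by fun_prop)

theorem euclidStep_add_left {x y : ℝ} (hx : 0 < x) : euclidStep (x + y, y) = (x, y) := by
  simp [euclidStep, hx]

theorem euclidStep_add_right {x y : ℝ} (hy : 0 < y) : euclidStep (x, x + y) = (x, y) := by
  simp [euclidStep, hy.le]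

/-- The points whose orbit meets a forward invariant set form an invariant set. -/
theorem euclidInvariant_iUnion_preimage {S : Set (ℝ × ℝ)} (hS : ∀ w ∈ S, euclidStep w ∈ S) :
    EuclidInvariant (⋃ n, euclidStep^[n] ⁻¹' S) := by
  have key : ∀ w, w ∈ (⋃ n, euclidStep^[n] ⁻¹' S) ↔ euclidStep w ∈ ⋃ n, euclidStep^[n] ⁻¹' S := by
    intro w
    simp only [Set.mem_iUnion, Set.mem_preimage]
    constructor
    · rintro ⟨n, hn⟩
      refine ⟨n, ?_⟩
      rw [← Function.iterate_succ_apply, Function.iterate_succ_apply']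
      exact hS _ hn
    · rintro ⟨n, hn⟩
      exact ⟨n + 1, hn⟩
  constructor
  · intro x y hx _
    rw [key, euclidStep_add_left hx]
  · intro x y _ hy
    rw [key, euclidStep_add_right hy]

/-! ### Orbits of the generalized Euclidean algorithm -/

/-- If at each step either `g y` is subtracted from `x` or `h x` from `y`, and both sequences stay
positive, then `x` becomes arbitrarily small. Otherwise every subtraction from `y` is bounded below,
so once `y` is close to its infimum only `x` changes, by the same positive amount each time. -/
theorem exists_lt_of_subtractive_steps {x y : ℕ → ℝ} {g h : ℝ → ℝ} (hx : ∀ n, 0 < x n)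
    (hy : ∀ n, 0 < y n) (hg : ∀ t, 0 < t → 0 < g t) (hh : ∀ t, 0 < t → 0 < h t) (hmono : Monotone h)
    (hstep : ∀ n, (x (n + 1) = x n - g (y n) ∧ y (n + 1) = y n) ∨
      (x (n + 1) = x n ∧ y (n + 1) = y n - h (x n))) {c : ℝ} (hc : 0 < c) : ∃ n, x n < c := by
  by_contra! hcon
  have hbdd : BddBelow (Set.range y) := ⟨0, by rintro _ ⟨n, rfl⟩; exact (hy n).le⟩
  have hanti : Antitone y := antitone_nat_of_succ_le fun n => by
    rcases hstep n with h1 | h1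
    · exact h1.2.le
    · linarith [hh _ (hx n)]
  obtain ⟨n, hn⟩ := exists_lt_of_ciInf_lt (lt_add_of_pos_right (⨅ i, y i) (hh c hc))
  have hhor : ∀ k, x (n + k) = x n - k * g (y n) ∧ y (n + k) = y n := by
    intro k
    induction k with
    | zero => simp
    | succ k ih =>
      rcases hstep (n + k) with h1 | h1
      · rw [← add_assoc, h1.1, h1.2, ih.1, ih.2]
        push_cast
        exact ⟨by ring, rfl⟩
      · exfalso
        have h2 := ciInf_le hbdd (n + k + 1)
        have h3 := hmono (hcon (n + k))
        linarith [hanti (Nat.le_add_right n k)]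
  obtain ⟨k, hk⟩ := exists_nat_gt (x n / g (y n))
  rw [div_lt_iff₀ (hg _ (hy n))] at hk
  linarith [hx (n + k), (hhor k).1]

section
variable {σ : ℝ ≃ₜ ℝ} {hσ : StrictMono σ}

theorem strictMono_symm (hσ : StrictMono σ) : StrictMono σ.symm := fun x y h => by
  rw [← hσ.lt_iff_lt]; simpa using h

theorem generalizedEuclid_step (p : PosQuadrant) :
    ((generalizedEuclid σ hσ p).1.1 = p.1.1 - σ.symm p.1.2 ∧
        (generalizedEuclid σ hσ p).1.2 = p.1.2) ∨
      ((generalizedEuclid σ hσ p).1.1 = p.1.1 ∧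
        (generalizedEuclid σ hσ p).1.2 = p.1.2 - σ p.1.1) := by
  unfold generalizedEuclid
  split_ifs with h
  · exact Or.inl ⟨rfl, rfl⟩
  · exact Or.inr ⟨rfl, rfl⟩

theorem measurable_generalizedEuclid : Measurable (generalizedEuclid σ hσ) := by
  have h1 : Measurable fun p : PosQuadrant => (generalizedEuclid σ hσ p).1 := by
    have e : (fun p : PosQuadrant => (generalizedEuclid σ hσ p).1) = fun p : PosQuadrant =>
        if p.1.2 < σ p.1.1 then (p.1.1 - σ.symm p.1.2, p.1.2) else (p.1.1, p.1.2 - σ p.1.1) := by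
      funext p
      unfold generalizedEuclid
      split_ifs <;> rfl
    have hs := σ.continuous.measurable
    have hs' := σ.symm.continuous.measurable
    rw [e]
    exact Measurable.ite (measurableSet_lt (by fun_prop) (by fun_prop)) (by fun_prop)
      (by fun_prop)
  exact h1.subtype_mk

theorem measurableEmbedding_posQuadrant :
    MeasurableEmbedding (Subtype.val : PosQuadrant → ℝ × ℝ) :=
  MeasurableEmbedding.subtype_coe
    ((measurableSet_le measurable_const measurable_fst).inter
      (measurableSet_le measurable_const measurable_snd))

theorem lebesgueQuadrant_apply (s : Set PosQuadrant) :
    lebesgueQuadrant s = volume (Subtype.val '' s) :=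
  measurableEmbedding_posQuadrant.comap_apply _ _

theorem measurePreserving_shear_snd {g : ℝ → ℝ} (hg : Measurable g) :
    MeasurePreserving (fun w : ℝ × ℝ => (w.1, w.2 - g w.1)) :=
  (MeasurePreserving.id volume).skew_product (g := fun x y => y - g x)
    (measurable_snd.sub (hg.comp measurable_fst))
    (Filter.Eventually.of_forall fun x => (measurePreserving_sub_right volume (g x)).map_eq)

theorem measurePreserving_shear_fst {g : ℝ → ℝ} (hg : Measurable g) :
    MeasurePreserving (fun w : ℝ × ℝ => (w.1 - g w.2, w.2)) :=
  (Measure.measurePreserving_swap.comp (measurePreserving_shear_snd hg)).comp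
    Measure.measurePreserving_swap

theorem quasiMeasurePreserving_generalizedEuclid :
    Measure.QuasiMeasurePreserving (generalizedEuclid σ hσ) lebesgueQuadrant lebesgueQuadrant := by
  refine ⟨measurable_generalizedEuclid, Measure.AbsolutelyContinuous.mk fun s hs h0 => ?_⟩
  rw [Measure.map_apply measurable_generalizedEuclid hs, lebesgueQuadrant_apply]
  rw [lebesgueQuadrant_apply] at h0
  have n1 := (measurePreserving_shear_fst
    σ.symm.continuous.measurable).quasiMeasurePreserving.preimage_null h0
  have n2 := (measurePreserving_shear_snd
    σ.continuous.measurable).quasiMeasurePreserving.preimage_null h0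
  refine measure_mono_null ?_ (measure_union_null n1 n2)
  rintro _ ⟨p, hp, rfl⟩
  rcases generalizedEuclid_step (hσ := hσ) p with h | h
  · exact Or.inl ⟨_, hp, Prod.ext h.1 h.2⟩
  · exact Or.inr ⟨_, hp, Prod.ext h.1 h.2⟩

theorem volume_axes : volume {w : ℝ × ℝ | w.1 = 0 ∨ w.2 = 0} = 0 := by
  have e : {w : ℝ × ℝ | w.1 = 0 ∨ w.2 = 0} = ({0} ×ˢ Set.univ) ∪ (Set.univ ×ˢ {0}) := by
    ext w; simp
  rw [e, Measure.volume_eq_prod]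
  exact measure_union_null (by rw [Measure.prod_prod]; simp) (by rw [Measure.prod_prod]; simp)

/-- An orbit that stays off the axes enters every box at the origin. -/
theorem exists_iterate_generalizedEuclid_le (h0 : σ 0 = 0) {p : PosQuadrant}
    (hp : ∀ n, 0 < ((generalizedEuclid σ hσ)^[n] p).1.1 ∧
      0 < ((generalizedEuclid σ hσ)^[n] p).1.2) {c d : ℝ} (hc : 0 < c) (hd : 0 < d) :
    ∃ n, ((generalizedEuclid σ hσ)^[n] p).1.1 ≤ c ∧ ((generalizedEuclid σ hσ)^[n] p).1.2 ≤ d := by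
  have h0' : σ.symm 0 = 0 := by rw [Homeomorph.symm_apply_eq, h0]
  have hg : ∀ t, 0 < t → 0 < σ t := fun t ht => h0 ▸ hσ ht
  have hg' : ∀ t, 0 < t → 0 < σ.symm t := fun t ht => h0' ▸ strictMono_symm hσ ht
  set x : ℕ → ℝ := fun n => ((generalizedEuclid σ hσ)^[n] p).1.1 with hx
  set y : ℕ → ℝ := fun n => ((generalizedEuclid σ hσ)^[n] p).1.2 with hy
  have hstep : ∀ n, (x (n + 1) = x n - σ.symm (y n) ∧ y (n + 1) = y n) ∨
      (x (n + 1) = x n ∧ y (n + 1) = y n - σ (x n)) := by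
    intro n
    simp only [hx, hy, Function.iterate_succ_apply']
    exact generalizedEuclid_step _
  obtain ⟨n, hn⟩ := exists_lt_of_subtractive_steps (fun n => (hp n).1) (fun n => (hp n).2) hg' hg
    hσ.monotone hstep hc
  obtain ⟨m, hm⟩ := exists_lt_of_subtractive_steps (fun n => (hp n).2) (fun n => (hp n).1) hg hg'
    (strictMono_symm hσ).monotone (fun n => (hstep n).symm.imp And.symm And.symm) hd
  have hxa : Antitone x := antitone_nat_of_succ_le fun k => by
    rcases hstep k with h | h
    · linarith [hg' _ (hp k).2]
    · exact h.1.le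
  have hya : Antitone y := antitone_nat_of_succ_le fun k => by
    rcases hstep k with h | h
    · exact h.2.le
    · linarith [hg _ (hp k).1]
  exact ⟨max n m, (hxa (le_max_left n m)).trans hn.le, (hya (le_max_right n m)).trans hm.le⟩

/-- The box `[0, c] × [0, d]`, as a subset of the quadrant. -/
def quadrantBox (c d : ℝ) : Set PosQuadrant := {p | p.1.1 ≤ c ∧ p.1.2 ≤ d}

theorem measurableSet_quadrantBox (c d : ℝ) : MeasurableSet (quadrantBox c d) :=
  (measurableSet_le (measurable_fst.comp measurable_subtype_coe) measurable_const).inter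
    (measurableSet_le (measurable_snd.comp measurable_subtype_coe) measurable_const)

/-- Almost every orbit enters the box, so an invariant set that is null there is null. -/
theorem lebesgueQuadrant_eq_zero_of_inter_box (h0 : σ 0 = 0) {c d : ℝ} (hc : 0 < c) (hd : 0 < d)
    {T : Set PosQuadrant} (hT : generalizedEuclid σ hσ ⁻¹' T = T)
    (hbox : lebesgueQuadrant (T ∩ quadrantBox c d) = 0) : lebesgueQuadrant T = 0 := by
  set E := generalizedEuclid σ hσ with hE
  set Z : Set PosQuadrant := {p | p.1.1 = 0 ∨ p.1.2 = 0} with hZ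
  have hZ0 : lebesgueQuadrant Z = 0 := by
    rw [lebesgueQuadrant_apply]
    refine measure_mono_null ?_ volume_axes
    rintro _ ⟨p, hp, rfl⟩
    exact hp
  have hq : ∀ n, Measure.QuasiMeasurePreserving E^[n] lebesgueQuadrant lebesgueQuadrant :=
    fun n => quasiMeasurePreserving_generalizedEuclid.iterate n
  have hTn : ∀ n, ∀ p ∈ T, E^[n] p ∈ T := by
    intro n p hp
    have : E^[n] ⁻¹' T = T := by
      rw [Set.preimage_iterate_eq]
      exact Function.iterate_fixed hT n
    exact this.symm.subset hp
  refine measure_mono_null (t := (⋃ n, E^[n] ⁻¹' (T ∩ quadrantBox c d)) ∪ ⋃ n, E^[n] ⁻¹' Z) ?_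
    (measure_union_null (measure_iUnion_null fun n => (hq n).preimage_null hbox)
      (measure_iUnion_null fun n => (hq n).preimage_null hZ0))
  intro p hp
  by_cases hz : ∃ n, E^[n] p ∈ Z
  · exact Or.inr (Set.mem_iUnion.2 hz)
  · push Not at hz
    obtain ⟨n, hn⟩ := exists_iterate_generalizedEuclid_le (hσ := hσ) h0 (p := p) (fun n =>
      ⟨(E^[n] p).2.1.lt_of_ne fun h => hz n (Or.inl h.symm),
        (E^[n] p).2.2.lt_of_ne fun h => hz n (Or.inr h.symm)⟩) hc hd
    exact Or.inl (Set.mem_iUnion.2 ⟨n, hTn n p hp, hn⟩)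

/-- Where `σ` is linear, the scaling `w ↦ (w.1 / a, w.2)` conjugates the Euclidean algorithm to the
generalized one, and the box is forward invariant. -/
theorem generalizedEuclid_eq_euclidStep {a b : ℝ} (ha : 0 < a)
    (hlin : ∀ x ∈ Set.Icc (-b) b, σ x = a * x) {p : PosQuadrant}
    (hp : p ∈ quadrantBox b (a * b)) {w : ℝ × ℝ} (hw : p.1 = (w.1 / a, w.2)) :
    (generalizedEuclid σ hσ p).1 = ((euclidStep w).1 / a, (euclidStep w).2) ∧
      generalizedEuclid σ hσ p ∈ quadrantBox b (a * b) := by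
  have h1 : p.1.1 = w.1 / a := by rw [hw]
  have h2 : p.1.2 = w.2 := by rw [hw]
  obtain ⟨hx0, hy0⟩ := p.2
  obtain ⟨hxb, hyb⟩ := hp
  have hσx : σ p.1.1 = w.1 := by
    rw [hlin _ ⟨by linarith, hxb⟩, h1]; field_simp
  have hσy : σ.symm p.1.2 = w.2 / a := by
    have hya : p.1.2 / a ≤ b := by rw [div_le_iff₀ ha]; linarith
    have hya0 : 0 ≤ p.1.2 / a := div_nonneg hy0 ha.le
    rw [Homeomorph.symm_apply_eq, ← h2, hlin _ ⟨by linarith, hya⟩]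
    field_simp
  have hw1 : 0 ≤ w.1 := by
    rw [h1, le_div_iff₀ ha, zero_mul] at hx0
    exact hx0
  rw [h2] at hy0 hyb
  rw [h1] at hxb
  unfold generalizedEuclid euclidStep quadrantBox
  by_cases h : w.2 < w.1
  · have h' : p.1.2 < σ p.1.1 := by rw [hσx, h2]; exact h
    rw [dif_pos h', if_pos h]
    refine ⟨Prod.ext ?_ h2, ?_, ?_⟩
    · simp only; rw [hσy, h1, sub_div]
    · simp only
      rw [hσy, h1]
      linarith [div_nonneg hy0 ha.le]
    · simp only; rw [h2]; exact hyb
  · have h' : ¬ p.1.2 < σ p.1.1 := by rw [hσx, h2]; exact h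
    rw [dif_neg h', if_neg h]
    refine ⟨Prod.ext h1 ?_, ?_, ?_⟩
    · simp only; rw [hσx, h2]
    · simp only; rw [h1]; exact hxb
    · simp only
      rw [hσx, h2]
      linarith
end

/-! ### Ergodicity -/

theorem mainTheorem4 (σ : ℝ ≃ₜ ℝ) (hmono : StrictMono σ) (hodd : Function.Odd σ)
    (a b : ℝ) (ha : 0 < a) (hb : 0 < b) (hlin : ∀ x ∈ Set.Icc (-b) b, σ x = a * x) :
    QuasiErgodic (generalizedEuclid σ hmono) lebesgueQuadrant := by
  refine { quasiMeasurePreserving_generalizedEuclid with aeconst_set := fun A hAm hA => ?_ }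
  have h0 : σ 0 = 0 := hodd.map_zero
  have hab : 0 < a * b := mul_pos ha hb
  set E := generalizedEuclid σ hmono with hE
  set B := quadrantBox b (a * b) with hB
  set S : Set (ℝ × ℝ) := (fun w : ℝ × ℝ => (w.1 / a, w.2)) ⁻¹' (Subtype.val '' (A ∩ B)) with hS
  have hSm : MeasurableSet S :=
    (measurableEmbedding_posQuadrant.measurableSet_image.2
      (hAm.inter (measurableSet_quadrantBox _ _))).preimage (by fun_prop)
  have hmem : ∀ p, E p ∈ A ↔ p ∈ A := fun p => by
    conv_rhs => rw [← hA]
    rfl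
  have hS1 : ∀ w ∈ S, euclidStep w ∈ S := by
    rintro w ⟨p, ⟨hpA, hpB⟩, hpw⟩
    obtain ⟨h1, h2⟩ := generalizedEuclid_eq_euclidStep (hσ := hmono) ha hlin hpB hpw
    exact ⟨E p, ⟨(hmem p).2 hpA, h2⟩, h1⟩
  -- the points of the plane whose Euclidean orbit meets the scaled copy `S` of `A ∩ B`
  set D : Set (ℝ × ℝ) := ⋃ n, euclidStep^[n] ⁻¹' S with hD
  have hDm : MeasurableSet D :=
    MeasurableSet.iUnion fun n => (measurable_euclidStep.iterate n) hSm
  -- the extension `D` agrees with `A` in the box, where the two algorithms are conjugate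
  have hDB : ∀ p ∈ B, ∀ w : ℝ × ℝ, p.1 = (w.1 / a, w.2) → (w ∈ D ↔ p ∈ A) := by
    intro p hpB w hpw
    constructor
    · intro hwD
      obtain ⟨n, hn⟩ := Set.mem_iUnion.1 hwD
      clear hwD
      induction n generalizing p w with
      | zero =>
        obtain ⟨p', ⟨hpA, -⟩, hpw'⟩ := hn
        rwa [Subtype.ext (hpw.trans hpw'.symm)]
      | succ n ih =>
        obtain ⟨h1, h2⟩ := generalizedEuclid_eq_euclidStep (hσ := hmono) ha hlin hpB hpw
        exact (hmem p).1 (ih (E p) h2 (euclidStep w) h1 hn)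
    · intro hpA
      exact Set.mem_iUnion.2 ⟨0, p, ⟨hpA, hpB⟩, hpw⟩
  have hnull : ∀ (T : Set PosQuadrant) (P : Set (ℝ × ℝ)), volume (openQuadrant ∩ P) = 0 →
      (∀ p ∈ T ∩ B, (a * p.1.1, p.1.2) ∈ P) → lebesgueQuadrant (T ∩ B) = 0 := by
    intro T P hP hTP
    rw [lebesgueQuadrant_apply]
    refine measure_mono_null ?_ (measure_union_null volume_axes
      (addHaar_image_eq_zero_of_differentiableOn_of_addHaar_eq_zero
        (f := fun w : ℝ × ℝ => (w.1 / a, w.2)) volume (by fun_prop) hP))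
    rintro _ ⟨p, hp, rfl⟩
    by_cases hz : p.1.1 = 0 ∨ p.1.2 = 0
    · exact Or.inl hz
    · push Not at hz
      refine Or.inr ⟨(a * p.1.1, p.1.2), ⟨⟨?_, ?_⟩, hTP p hp⟩, ?_⟩
      · exact mul_pos ha (p.2.1.lt_of_ne hz.1.symm)
      · exact p.2.2.lt_of_ne hz.2.symm
      · simp [ha.ne']
  have hscale : ∀ p : PosQuadrant, p.1 = ((a * p.1.1) / a, p.1.2) := fun p => by simp [ha.ne']
  rw [Filter.eventuallyConst_set']
  rcases (euclidInvariant_iUnion_preimage hS1).null_or_conull hDm with h | h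
  · left
    rw [ae_eq_empty]
    exact lebesgueQuadrant_eq_zero_of_inter_box h0 hb hab hA
      (hnull A D h fun p hp => (hDB p hp.2 _ (hscale p)).2 hp.1)
  · right
    rw [ae_eq_univ]
    refine lebesgueQuadrant_eq_zero_of_inter_box (hσ := hmono) h0 hb hab
      (by rw [Set.preimage_compl, hA]) (hnull Aᶜ Dᶜ h fun p hp => ?_)
    exact fun hwD => hp.1 ((hDB p hp.2 _ (hscale p)).1 hwD)
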